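/- **Theorem (Approximating the superoperator $\mathcal S$).** For a Hermitian matrix $H\in\mathbb C^{d\times d}$ let $$\mathcal S[A]=\int_{\mathbb R}\frac{\mathrm i}{\sinh(2\pi t)}\left(\mathrm e^{\mathrm iHt}A\,\mathrm e^{-\mathrm iHt}-A\right)\mathrm dt,\qquad A\in\mathbb C^{d\times d},$$ and let $\|\cdot\|$ be the operator norm. A unitary $U$ on ($a$ ancilla qubits) $\otimes\,\mathbb C^d$ is a block-encoding of $A$ if $(\langle 0|^{\otimes a}\otimes I)\,U\,(|0\rangle^{\otimes a}\otimes I)=A$. An algorithm with $m$ work qubits and black-box access to $U$ is a finite sequence of the following steps: unitaries acting on the work qubits only; Hamiltonian simulation $\mathrm e^{\mathrm iHt}$ ($t\in\mathbb R$) on the system, possibly controlled on a work qubit; and uses of $U$. Its (controlled) Hamiltonian simulation time is the sum of $|t|$ over all its (controlled) Hamiltonian simulation steps. There is a universal constant $C>0$ such that for every $h>0$ and every $\varepsilon\in(0,\frac13]$ there is an algorithm, depending only on $h$ and $\varepsilon$, that uses $U$ exactly once, has (controlled) Hamiltonian simulation time at most $C\ln(1/\varepsilon)$ (that is, $\widetilde{\mathcal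 O}(1)$, where $\widetilde{\mathcal O}$ hides polylogarithmic factors), and has the following property. For every $d$ and every Hermitian $H\in\mathbb C^{d\times d}$ with $\|H\|=h$ there is a linear map $\widetilde{\mathcal S}$ on $\mathbb C^{d\times d}$ such that for every $A\in\mathbb C^{d\times d}$ with $\|A\|\le 1$ we have $$\|\mathcal S[A]-\widetilde{\mathcal S}[A]\|\le\varepsilon,$$ and, for every block-encoding $U$ of $A$ (with any number of ancilla qubits), the algorithm run with $H$ and $U$ implements a block-encoding of $$\frac{\pi\,\widetilde{\mathcal S}[A]}{\ln\left(1+\frac{2\|H\|}{\pi\varepsilon}\right)}.$$ -/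

import Mathlib

open scoped Matrix.Norms.L2Operator Kronecker

noncomputable section

namespace QGibbs

/-- The computational basis states of a register of `a` qubits. -/
abbrev Qubits (a : ℕ) := Fin a → Fin 2

/-- The time-evolution operator `e^{iHt}`. -/
def evolution {d : ℕ} (H : Matrix (Fin d) (Fin d) ℂ) (t : ℝ) : Matrix (Fin d) (Fin d) ℂ :=
  NormedSpace.exp ((Complex.I * (t : ℂ)) • H)

/-- The superoperator
`S[A] = ∫_ℝ (i / sinh (2πt)) (e^{iHt} A e^{-iHt} - A) dt`.
The integrand is bounded near `t = 0` and decays exponentially, so that for Hermitian `H` this is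
an absolutely convergent integral. -/
def superS {d : ℕ} (H A : Matrix (Fin d) (Fin d) ℂ) : Matrix (Fin d) (Fin d) ℂ :=
  ∫ t : ℝ, (Complex.I / ((Real.sinh (2 * Real.pi * t) : ℝ) : ℂ)) •
    (evolution H t * A * evolution H (-t) - A)

/-- `U` is a block-encoding of `A`: it is a unitary on ancilla ⊗ system, and
`(⟨0| ⊗ I) U (|0⟩ ⊗ I) = A`. Here `κ` indexes the basis of the ancilla, and `0 : κ` is its
all-zeros state. -/
def IsBlockEncoding {κ : Type} [Fintype κ] [DecidableEq κ] [Zero κ] {d : ℕ}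
    (U : Matrix (κ × Fin d) (κ × Fin d) ℂ) (A : Matrix (Fin d) (Fin d) ℂ) : Prop :=
  U ∈ Matrix.unitaryGroup (κ × Fin d) ℂ ∧ ∀ i j, U (0, i) (0, j) = A i j

/-- The elementary steps of an algorithm with `m` work qubits that has black-box access to a
unitary `U` (a block-encoding) and to the Hamiltonian evolution on the system. -/
inductive Step (m : ℕ) where
  /-- a unitary acting on the work qubits only -/
  | work (W : Matrix.unitaryGroup (Qubits m) ℂ)
  /-- Hamiltonian simulation: apply `e^{iHt}` to the system -/
  | sim (t : ℝ)
  /-- controlled Hamiltonian simulation: apply `e^{iHt}` to the system if the work qubit `k` is in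
  the state `|1⟩` -/
  | ctrlSim (k : Fin m) (t : ℝ)
  /-- a use of the black-box unitary `U` -/
  | query

/-- The projector onto the span of the basis states of the work register whose qubit `k` equals
`b`. -/
def qubitProj {m : ℕ} (k : Fin m) (b : Fin 2) : Matrix (Qubits m) (Qubits m) ℂ :=
  Matrix.diagonal fun s => if s k = b then 1 else 0

/-- The operator that a step implements on (work qubits ⊗ ancilla qubits of `U`) ⊗ system. -/
def Step.eval {m a d : ℕ} (H : Matrix (Fin d) (Fin d) ℂ)
    (U : Matrix (Qubits a × Fin d) (Qubits a × Fin d) ℂ) :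
    Step m → Matrix ((Qubits m × Qubits a) × Fin d) ((Qubits m × Qubits a) × Fin d) ℂ
  | .work W =>
      ((W : Matrix (Qubits m) (Qubits m) ℂ) ⊗ₖ (1 : Matrix (Qubits a) (Qubits a) ℂ)) ⊗ₖ
        (1 : Matrix (Fin d) (Fin d) ℂ)
  | .sim t => (1 : Matrix (Qubits m × Qubits a) (Qubits m × Qubits a) ℂ) ⊗ₖ evolution H t
  | .ctrlSim k t =>
      (qubitProj k 0 ⊗ₖ (1 : Matrix (Qubits a) (Qubits a) ℂ)) ⊗ₖ
          (1 : Matrix (Fin d) (Fin d) ℂ) +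
        (qubitProj k 1 ⊗ₖ (1 : Matrix (Qubits a) (Qubits a) ℂ)) ⊗ₖ evolution H t
  | .query =>
      ((1 : Matrix (Qubits m) (Qubits m) ℂ) ⊗ₖ U).submatrix
        (Equiv.prodAssoc _ _ _) (Equiv.prodAssoc _ _ _)

/-- An algorithm with `m` work qubits: a finite sequence of steps, the first one applied first.
It refers neither to `U`, nor to the Hamiltonian, nor to the dimension of the system. -/
abbrev Algorithm (m : ℕ) := List (Step m)

/-- The operator that an algorithm implements for the Hamiltonian `H` and the black box `U`. -/
def Algorithm.eval {m a d : ℕ} (H : Matrix (Fin d) (Fin d) ℂ)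
    (U : Matrix (Qubits a × Fin d) (Qubits a × Fin d) ℂ) :
    Algorithm m → Matrix ((Qubits m × Qubits a) × Fin d) ((Qubits m × Qubits a) × Fin d) ℂ
  | [] => 1
  | g :: gs => Algorithm.eval H U gs * g.eval H U

/-- The number of uses of `U` in a step. -/
def Step.queries {m : ℕ} : Step m → ℕ
  | .query => 1
  | _ => 0

/-- The (controlled) Hamiltonian simulation time of a step. -/
def Step.simTime {m : ℕ} : Step m → ℝ
  | .sim t => |t|
  | .ctrlSim _ t => |t|
  | _ => 0

/-- The number of uses of `U` in an algorithm. -/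
def Algorithm.queries {m : ℕ} (c : Algorithm m) : ℕ := (c.map Step.queries).sum

/-- The total (controlled) Hamiltonian simulation time of an algorithm. -/
def Algorithm.simTime {m : ℕ} (c : Algorithm m) : ℝ := (c.map Step.simTime).sum

end QGibbs

end

/-!
The superoperator is approximated by a finite linear combination of the operators
`e^{iHτ} A e^{-iHτ}` (`heisenberg`), which a circuit implements with a single query.

*The approximation.* The kernel `i / sinh (2πt)` is cut off at `|t| ≤ δ`. As the remaining kernel is
odd and integrable, the subtracted term `A` drops out, and the time may be rounded to a grid of mesh
`T / M` on `[-T, T]`; the coefficient of a grid time is the integral of the cut-off kernel over the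
times rounded to it. Since `‖e^{iHt} A e^{-iHt} - A‖ ≤ 2 ‖H‖ |t|` and `sinh x ≥ x`, the cutoff costs
at most `2 δ ‖H‖ / π`, the rounding costs `2 ‖H‖ T / M` times the `L¹`-norm of the kernel, and the
times outside of `[-T, T]` cost twice the `L¹`-norm of the tail of the kernel
(`norm_superS_sub_discreteS_le`). The tail is exponentially small, so that `T = ln (1/ε)` suffices,
and `M` may be as large as is needed because only the simulation time is counted.

*The normalization.* An antiderivative of the kernel is `ln (tanh (πt)) / (2π)`. With
`δ = ln (1 + πε/h) / (2π)`, which costs at most `ε / π`, the `L¹`-norm of the cut-off kernel is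
exactly `ln (1 + 2h/(πε)) / π` (`integral_truncKernel_cutoff`). A grid cell never contains times of
both signs in its interior, so the absolute values of the coefficients add up to this number and no
padding of the linear combination is needed.

*The circuit.* Grid times are stored in a thermometer code, one work qubit for each mesh interval,
so that controlled simulation for the time `T / M` on each work qubit, together with an
unconditional simulation for the time `-T`, evolves the system by the stored time at a total cost of
`3T`. Conjugating the query by this evolution, with suitable unitaries of the work register at both
ends, block-encodes the normalized linear combination (`isBlockEncoding_lcuAlgorithm`,
`exists_unitary_kernelMass`).
-/

/-! ### Hamiltonian evolution -/

namespace QGibbs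

section Evolution

variable {d : ℕ} {H : Matrix (Fin d) (Fin d) ℂ}

@[simp]
theorem evolution_zero (H : Matrix (Fin d) (Fin d) ℂ) : evolution H 0 = 1 := by
  simp [evolution]

theorem evolution_add (H : Matrix (Fin d) (Fin d) ℂ) (s t : ℝ) :
    evolution H (s + t) = evolution H s * evolution H t := by
  unfold evolution
  rw [← Matrix.exp_add_of_commute _ _ (((Commute.refl H).smul_right _).smul_left _), ← add_smul]
  push_cast
  rw [mul_add]

theorem conjTranspose_evolution (hH : H.IsHermitian) (t : ℝ) :
    (evolution H t).conjTranspose = evolution H (-t) := by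
  unfold evolution
  rw [← Matrix.exp_conjTranspose, Matrix.conjTranspose_smul, hH.eq]
  simp

theorem evolution_mem_unitary (hH : H.IsHermitian) (t : ℝ) :
    evolution H t ∈ unitary (Matrix (Fin d) (Fin d) ℂ) := by
  rw [Unitary.mem_iff]
  simp only [Matrix.star_eq_conjTranspose, conjTranspose_evolution hH, ← evolution_add]
  simp

theorem hasDerivAt_evolution (H : Matrix (Fin d) (Fin d) ℂ) (t : ℝ) :
    HasDerivAt (evolution H) (evolution H t * (Complex.I • H)) t := by
  have h := (hasDerivAt_exp_smul_const (𝕂 := ℂ) (Complex.I • H) (t : ℂ)).scomp t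
    (Complex.ofRealCLM.hasDerivAt (x := t))
  simpa [evolution, Function.comp_def, smul_smul, mul_comm] using! h

theorem continuous_evolution (H : Matrix (Fin d) (Fin d) ℂ) : Continuous (evolution H) :=
  continuous_iff_continuousAt.2 fun t => (hasDerivAt_evolution H t).continuousAt

theorem norm_evolution_sub_le (hH : H.IsHermitian) (s t : ℝ) :
    ‖evolution H t - evolution H s‖ ≤ ‖H‖ * |t - s| := by
  refine Convex.norm_image_sub_le_of_norm_hasDerivWithin_le (s := Set.univ)
    (fun x _ => (hasDerivAt_evolution H x).hasDerivWithinAt) (fun x _ => ?_) convex_univ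
    (Set.mem_univ s) (Set.mem_univ t)
  rw [CStarRing.norm_mem_unitary_mul _ (evolution_mem_unitary hH x), norm_smul]
  simp

/-- The observable `A` in the Heisenberg picture at time `t`. -/
noncomputable def heisenberg (H A : Matrix (Fin d) (Fin d) ℂ) (t : ℝ) :
    Matrix (Fin d) (Fin d) ℂ :=
  evolution H t * A * evolution H (-t)

@[simp]
theorem heisenberg_zero (H A : Matrix (Fin d) (Fin d) ℂ) : heisenberg H A 0 = A := by
  simp [heisenberg]

theorem continuous_heisenberg (H A : Matrix (Fin d) (Fin d) ℂ) :
    Continuous (heisenberg H A) :=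
  ((continuous_evolution H).mul continuous_const).mul
    ((continuous_evolution H).comp continuous_neg)

theorem norm_heisenberg (hH : H.IsHermitian) (A : Matrix (Fin d) (Fin d) ℂ) (t : ℝ) :
    ‖heisenberg H A t‖ = ‖A‖ := by
  rw [heisenberg, CStarRing.norm_mul_mem_unitary _ (evolution_mem_unitary hH _),
    CStarRing.norm_mem_unitary_mul _ (evolution_mem_unitary hH _)]

theorem norm_heisenberg_sub_le (hH : H.IsHermitian) (A : Matrix (Fin d) (Fin d) ℂ) (s t : ℝ) :
    ‖heisenberg H A t - heisenberg H A s‖ ≤ 2 * ‖H‖ * ‖A‖ * |t - s| := by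
  have key : heisenberg H A t - heisenberg H A s =
      (evolution H t - evolution H s) * A * evolution H (-t) +
        evolution H s * (A * (evolution H (-t) - evolution H (-s))) := by
    simp only [heisenberg]
    noncomm_ring
  have h₁ : ‖(evolution H t - evolution H s) * A * evolution H (-t)‖ ≤ ‖H‖ * |t - s| * ‖A‖ := by
    rw [CStarRing.norm_mul_mem_unitary _ (evolution_mem_unitary hH _)]
    exact (norm_mul_le _ _).trans
      (mul_le_mul_of_nonneg_right (norm_evolution_sub_le hH s t) (norm_nonneg _))
  have h₂ : ‖evolution H s * (A * (evolution H (-t) - evolution H (-s)))‖ ≤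
      ‖A‖ * (‖H‖ * |t - s|) := by
    rw [CStarRing.norm_mem_unitary_mul _ (evolution_mem_unitary hH _)]
    refine (norm_mul_le _ _).trans
      (mul_le_mul_of_nonneg_left ((norm_evolution_sub_le hH (-s) (-t)).trans_eq ?_)
        (norm_nonneg _))
    rw [← abs_neg, neg_sub_neg, neg_sub]
  rw [key]
  linarith [norm_add_le ((evolution H t - evolution H s) * A * evolution H (-t))
    (evolution H s * (A * (evolution H (-t) - evolution H (-s))))]

end Evolution

/-! ### State preparation -/

/-- Every unit vector is a column of a unitary matrix, since it extends to an orthonormal basis. -/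
theorem exists_unitary_col {ι : Type*} [Fintype ι] [DecidableEq ι] (i₀ : ι) (v : ι → ℂ)
    (hv : ∑ i, ‖v i‖ ^ 2 = 1) :
    ∃ W : Matrix.unitaryGroup ι ℂ, ∀ i, (W : Matrix ι ι ℂ) i i₀ = v i := by
  have hnorm : ‖WithLp.toLp 2 v‖ = 1 := by
    rw [EuclideanSpace.norm_eq]
    simp [hv]
  have hort : Orthonormal ℂ
      (Set.domRestrict ({i₀} : Set ι) (fun _ : ι => (WithLp.toLp 2 v : EuclideanSpace ℂ ι))) := by
    rw [orthonormal_iff_ite]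
    rintro ⟨i, rfl⟩ ⟨j, rfl⟩
    simp [hnorm]
  obtain ⟨b, hb⟩ := hort.exists_orthonormalBasis_extension_of_card_eq (by simp)
  refine ⟨⟨_, (EuclideanSpace.basisFun ι ℂ).toMatrix_orthonormalBasis_mem_unitary b⟩, fun i => ?_⟩
  simp [Module.Basis.toMatrix_apply, hb i₀ rfl]

theorem exists_unitary_row {ι : Type*} [Fintype ι] [DecidableEq ι] (i₀ : ι) (v : ι → ℂ)
    (hv : ∑ i, ‖v i‖ ^ 2 = 1) :
    ∃ W : Matrix.unitaryGroup ι ℂ, ∀ i, (W : Matrix ι ι ℂ) i₀ i = v i := by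
  obtain ⟨W, hW⟩ := exists_unitary_col i₀ (fun i => star (v i)) (by simpa using hv)
  exact ⟨star W, fun i => by simp [hW]⟩

/-! ### Controlled evolution and the circuit -/

section Circuit

variable {m a d : ℕ} {H : Matrix (Fin d) (Fin d) ℂ}
  {U : Matrix (Qubits a × Fin d) (Qubits a × Fin d) ℂ}

/-- The multiplexed evolution, which applies `e^{iHτ(s)}` to the system when the work register is
in the basis state `s`. -/
noncomputable def select (H : Matrix (Fin d) (Fin d) ℂ) (a : ℕ) (τ : Qubits m → ℝ) :
    Matrix ((Qubits m × Qubits a) × Fin d) ((Qubits m × Qubits a) × Fin d) ℂ :=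
  Matrix.of fun p q => if p.1 = q.1 then evolution H (τ p.1.1) p.2 q.2 else 0

theorem select_mul_apply (τ : Qubits m → ℝ)
    (X : Matrix ((Qubits m × Qubits a) × Fin d) ((Qubits m × Qubits a) × Fin d) ℂ)
    (r : Qubits m × Qubits a) (i : Fin d) (q : (Qubits m × Qubits a) × Fin d) :
    (select H a τ * X) (r, i) q = ∑ j, evolution H (τ r.1) i j * X (r, j) q := by
  rw [Matrix.mul_apply, Fintype.sum_prod_type, Finset.sum_eq_single r]
  · simp [select]
  · intro b _ hb
    simp [select, hb.symm]
  · simp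

theorem select_mul_select (σ τ : Qubits m → ℝ) :
    select H a σ * select H a τ = select H a (fun s => σ s + τ s) := by
  ext ⟨r, i⟩ ⟨r', i'⟩
  rw [select_mul_apply]
  by_cases h : r = r'
  · subst h
    simp [select, evolution_add, Matrix.mul_apply]
  · simp [select, h]

theorem select_zero : select H a (fun _ : Qubits m => 0) = 1 := by
  ext ⟨r, i⟩ ⟨r', i'⟩
  by_cases h : r = r'
  · subst h
    simp [select, Matrix.one_apply]
  · simp [select, h, Matrix.one_apply]

theorem conjTranspose_select (hH : H.IsHermitian) (τ : Qubits m → ℝ) :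
    (select H a τ).conjTranspose = select H a (fun s => -τ s) := by
  ext ⟨r, i⟩ ⟨r', i'⟩
  by_cases h : r = r'
  · subst h
    simp [select, ← conjTranspose_evolution hH]
  · simp [select, h, Ne.symm h]

theorem select_mem_unitaryGroup (hH : H.IsHermitian) (τ : Qubits m → ℝ) :
    select H a τ ∈ Matrix.unitaryGroup ((Qubits m × Qubits a) × Fin d) ℂ := by
  rw [Matrix.mem_unitaryGroup_iff, Matrix.star_eq_conjTranspose, conjTranspose_select hH,
    select_mul_select]
  simp [select_zero]

/-- Unconditional and controlled simulation are both multiplexed evolutions, with the time depending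
on the state of the work register. -/
theorem eval_sim (t : ℝ) :
    (Step.sim t : Step m).eval H U = select H a (fun _ => t) := by
  ext ⟨r, i⟩ ⟨r', i'⟩
  simp [Step.eval, select, Matrix.one_apply]

theorem eval_ctrlSim (k : Fin m) (t : ℝ) :
    (Step.ctrlSim k t : Step m).eval H U = select H a (fun s => if s k = 1 then t else 0) := by
  ext ⟨⟨s, x⟩, i⟩ ⟨⟨s', x'⟩, i'⟩
  by_cases hs : s = s'
  · subst hs
    by_cases hx : x = x'
    · subst hx
      obtain h | h : s k = 0 ∨ s k = 1 := by omega
      · simp [Step.eval, select, qubitProj, h, Matrix.one_apply]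
      · simp [Step.eval, select, qubitProj, h, Matrix.one_apply]
    · simp [Step.eval, select, qubitProj, hx, Matrix.one_apply]
  · simp [Step.eval, select, qubitProj, hs]

theorem Step.eval_mem_unitaryGroup (hH : H.IsHermitian)
    (hU : U ∈ Matrix.unitaryGroup (Qubits a × Fin d) ℂ) (g : Step m) :
    g.eval H U ∈ Matrix.unitaryGroup ((Qubits m × Qubits a) × Fin d) ℂ := by
  cases g with
  | work W =>
    exact Matrix.kronecker_mem_unitary (Matrix.kronecker_mem_unitary W.2 (one_mem _)) (one_mem _)
  | sim t => exact eval_sim (U := U) t ▸ select_mem_unitaryGroup hH _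
  | ctrlSim k t => exact eval_ctrlSim (U := U) k t ▸ select_mem_unitaryGroup hH _
  | query =>
    have h := Matrix.kronecker_mem_unitary (one_mem (Matrix.unitaryGroup (Qubits m) ℂ)) hU
    rw [Matrix.mem_unitaryGroup_iff, Matrix.star_eq_conjTranspose] at h ⊢
    rw [Step.eval, Matrix.conjTranspose_submatrix, Matrix.submatrix_mul_equiv, h,
      Matrix.submatrix_one_equiv]

theorem Algorithm.eval_mem_unitaryGroup (hH : H.IsHermitian)
    (hU : U ∈ Matrix.unitaryGroup (Qubits a × Fin d) ℂ) (c : Algorithm m) :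
    Algorithm.eval H U c ∈ Matrix.unitaryGroup ((Qubits m × Qubits a) × Fin d) ℂ := by
  induction c with
  | nil => exact one_mem _
  | cons g gs ih => exact mul_mem ih (g.eval_mem_unitaryGroup hH hU)

theorem Algorithm.eval_append (c₁ c₂ : Algorithm m) :
    Algorithm.eval H U (c₁ ++ c₂) = Algorithm.eval H U c₂ * Algorithm.eval H U c₁ := by
  induction c₁ with
  | nil => simp [Algorithm.eval]
  | cons g gs ih => simp only [List.cons_append, Algorithm.eval, ih, mul_assoc]

/-- The evolution for the time `t₀ + Δ · #{k | s k = 1}`, where `s` is the state of the work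
register: an unconditional simulation followed by one controlled simulation per work qubit. -/
def thermometerSim (m : ℕ) (t₀ Δ : ℝ) : Algorithm m :=
  .sim t₀ :: (List.finRange m).map fun k => .ctrlSim k Δ

/-- The simulation time which `thermometerSim` associates with a state of the work register. -/
def thermometerTime (t₀ Δ : ℝ) (s : Qubits m) : ℝ :=
  t₀ + ∑ k, if s k = 1 then Δ else 0

theorem eval_map_ctrlSim (l : List (Fin m)) (Δ : ℝ) :
    Algorithm.eval H U (l.map fun k => Step.ctrlSim k Δ) =
      select H a (fun s => (l.map fun k => if s k = 1 then Δ else 0).sum) := by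
  induction l with
  | nil => simp [Algorithm.eval, select_zero]
  | cons k l ih =>
    simp only [List.map_cons, Algorithm.eval, ih, eval_ctrlSim, select_mul_select, List.sum_cons]
    simp only [add_comm]

theorem eval_thermometerSim (t₀ Δ : ℝ) :
    Algorithm.eval H U (thermometerSim m t₀ Δ) = select H a (thermometerTime t₀ Δ) := by
  simp only [thermometerSim, Algorithm.eval, eval_map_ctrlSim, eval_sim, select_mul_select]
  congr 1
  ext s
  rw [thermometerTime, add_comm, ← List.ofFn_eq_map, List.sum_ofFn]

theorem queries_thermometerSim (t₀ Δ : ℝ) : Algorithm.queries (thermometerSim m t₀ Δ) = 0 := by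
  simp [Algorithm.queries, thermometerSim, Step.queries, Function.comp_def]

theorem simTime_thermometerSim (t₀ Δ : ℝ) :
    Algorithm.simTime (thermometerSim m t₀ Δ) = |t₀| + m * |Δ| := by
  simp [Algorithm.simTime, thermometerSim, Step.simTime, Function.comp_def]

theorem thermometerTime_neg (t₀ Δ : ℝ) (s : Qubits m) :
    thermometerTime (-t₀) (-Δ) s = -thermometerTime t₀ Δ s := by
  simp only [thermometerTime, neg_add, ← Finset.sum_neg_distrib]
  congr 2
  ext k
  split_ifs <;> simp

/-- The circuit for a linear combination of the operators `e^{iHτ} A e^{-iHτ}`: prepare the work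
register by `P`, evolve backwards for a time controlled by the register, query `A`, undo the
evolution, and apply `Q`. -/
def lcuAlgorithm (P Q : Matrix.unitaryGroup (Qubits m) ℂ) (t₀ Δ : ℝ) : Algorithm m :=
  .work P :: (thermometerSim m (-t₀) (-Δ) ++ .query :: (thermometerSim m t₀ Δ ++ [.work Q]))

theorem queries_lcuAlgorithm (P Q : Matrix.unitaryGroup (Qubits m) ℂ) (t₀ Δ : ℝ) :
    Algorithm.queries (lcuAlgorithm P Q t₀ Δ) = 1 := by
  have h := fun t₀ Δ => queries_thermometerSim (m := m) t₀ Δ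
  simp only [Algorithm.queries] at h
  simp [Algorithm.queries, lcuAlgorithm, Step.queries, h]

theorem simTime_lcuAlgorithm (P Q : Matrix.unitaryGroup (Qubits m) ℂ) (t₀ Δ : ℝ) :
    Algorithm.simTime (lcuAlgorithm P Q t₀ Δ) = 2 * (|t₀| + m * |Δ|) := by
  have h := fun t₀ Δ => simTime_thermometerSim (m := m) t₀ Δ
  simp only [Algorithm.simTime] at h
  simp only [Algorithm.simTime, lcuAlgorithm, Step.simTime, h, List.map_cons, List.map_append,
    List.sum_cons, List.sum_append, List.map_nil, List.sum_nil, abs_neg]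
  ring

theorem work_mul_apply (W : Matrix.unitaryGroup (Qubits m) ℂ)
    (X : Matrix ((Qubits m × Qubits a) × Fin d) ((Qubits m × Qubits a) × Fin d) ℂ)
    (s : Qubits m) (x : Qubits a) (i : Fin d) (q : (Qubits m × Qubits a) × Fin d) :
    ((Step.work W).eval H U * X) ((s, x), i) q =
      ∑ s', (W : Matrix _ _ ℂ) s s' * X ((s', x), i) q := by
  simp [Matrix.mul_apply, Fintype.sum_prod_type, Step.eval, Matrix.one_apply, ite_mul, mul_ite]

theorem query_mul_apply
    (X : Matrix ((Qubits m × Qubits a) × Fin d) ((Qubits m × Qubits a) × Fin d) ℂ)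
    (s : Qubits m) (x : Qubits a) (i : Fin d) (q : (Qubits m × Qubits a) × Fin d) :
    ((Step.query : Step m).eval H U * X) ((s, x), i) q =
      ∑ y, ∑ j, U (x, i) (y, j) * X ((s, y), j) q := by
  simp [Matrix.mul_apply, Fintype.sum_prod_type, Step.eval, Matrix.one_apply, ite_mul]

theorem select_mul_work_apply (τ : Qubits m → ℝ) (W : Matrix.unitaryGroup (Qubits m) ℂ)
    (s s' : Qubits m) (x x' : Qubits a) (i i' : Fin d) :
    (select H a τ * (Step.work W).eval H U) ((s, x), i) ((s', x'), i') =
      if x = x' then (W : Matrix _ _ ℂ) s s' * evolution H (τ s) i i' else 0 := by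
  rw [select_mul_apply]
  by_cases h : x = x' <;> simp [Step.eval, Matrix.one_apply, h, mul_comm]

/-- The linear combination of unitaries: the block which the circuit encodes has the products of
the first row of `Q` and the first column of `P` as its coefficients. -/
theorem isBlockEncoding_lcuAlgorithm (hH : H.IsHermitian) {A : Matrix (Fin d) (Fin d) ℂ}
    (hU : IsBlockEncoding U A) (P Q : Matrix.unitaryGroup (Qubits m) ℂ) (t₀ Δ : ℝ) :
    IsBlockEncoding (Algorithm.eval H U (lcuAlgorithm P Q t₀ Δ))
      (∑ s, ((Q : Matrix (Qubits m) (Qubits m) ℂ) 0 s * (P : Matrix (Qubits m) (Qubits m) ℂ) s 0) •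
        heisenberg H A (thermometerTime t₀ Δ s)) := by
  refine ⟨Algorithm.eval_mem_unitaryGroup hH hU.1 _, fun i j => ?_⟩
  simp only [lcuAlgorithm, Algorithm.eval, Algorithm.eval_append, eval_thermometerSim, one_mul,
    mul_assoc]
  rw [show (0 : Qubits m × Qubits a) = (0, 0) from rfl, work_mul_apply, Matrix.sum_apply]
  refine Finset.sum_congr rfl fun s _ => ?_
  rw [select_mul_apply, Matrix.smul_apply, smul_eq_mul, mul_assoc]
  congr 1
  simp only [query_mul_apply, select_mul_work_apply, thermometerTime_neg]
  -- The ancilla starts and ends in the state `0`, which selects the block `A` of `U`.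
  have h : ∀ k, ∑ y, ∑ l, U (0, k) (y, l) *
      (if y = 0 then (P : Matrix (Qubits m) (Qubits m) ℂ) s 0 * evolution H (-thermometerTime t₀ Δ s) l j else 0) =
      ∑ l, A k l * ((P : Matrix (Qubits m) (Qubits m) ℂ) s 0 * evolution H (-thermometerTime t₀ Δ s) l j) := by
    intro k
    rw [Finset.sum_eq_single 0 (fun y _ hy => by simp [hy]) (by simp)]
    simp [hU.2]
  simp only [h]
  rw [heisenberg, mul_assoc, Matrix.mul_apply, Finset.mul_sum]
  refine Finset.sum_congr rfl fun k _ => ?_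
  rw [Matrix.mul_apply, Finset.mul_sum, Finset.mul_sum, Finset.mul_sum]
  refine Finset.sum_congr rfl fun l _ => ?_
  ring

end Circuit

/-! ### The truncated kernel -/

section Kernel

open MeasureTheory Real Set Filter Topology

/-- The modulus of the kernel `1 / sinh (2πt)`, cut off at `|t| ≤ δ`. -/
noncomputable def truncKernel (δ t : ℝ) : ℝ := if δ < |t| then 1 / sinh (2 * π * |t|) else 0

theorem truncKernel_nonneg (δ t : ℝ) : 0 ≤ truncKernel δ t := by
  unfold truncKernel
  split_ifs
  · exact one_div_nonneg.2 (sinh_nonneg_iff.2 (by positivity))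
  · exact le_rfl

/-- The kernel splits into its right half and the mirror image of it. -/
theorem truncKernel_eq {δ : ℝ} (hδ : 0 < δ) (t : ℝ) :
    truncKernel δ t = (Ioi δ).indicator (fun u => 1 / sinh (2 * π * u)) t +
      (Ioi δ).indicator (fun u => 1 / sinh (2 * π * u)) (-t) := by
  unfold truncKernel
  rcases le_total 0 t with ht | ht
  · have : ¬ δ < -t := by linarith
    simp [indicator, abs_of_nonneg ht, this]
  · have : ¬ δ < t := by linarith
    simp [indicator, abs_of_nonpos ht, this]

theorem one_lt_exp_two_pi_mul {t : ℝ} (ht : 0 < t) : 1 < exp (2 * π * t) :=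
  one_lt_exp_iff.2 (by positivity)

/-- The function `ln (tanh (πt)) / (2π)`, with `tanh` written in terms of exponentials, is an
antiderivative of the kernel. -/
theorem hasDerivAt_log_tanh {t : ℝ} (ht : 0 < t) :
    HasDerivAt (fun t => 1 / (2 * π) * log ((exp (2 * π * t) - 1) / (exp (2 * π * t) + 1)))
      (1 / sinh (2 * π * t)) t := by
  have h1 := one_lt_exp_two_pi_mul ht
  have he : HasDerivAt (fun t => exp (2 * π * t)) (exp (2 * π * t) * (2 * π)) t := by
    simpa using ((hasDerivAt_id t).const_mul (2 * π)).exp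
  have hq := (he.sub_const 1).div (he.add_const 1) (by positivity)
  convert! (hq.log (div_pos (sub_pos.2 h1) (by positivity)).ne').const_mul (1 / (2 * π)) using 1
  rw [sinh_eq, exp_neg]
  generalize exp_y : exp (2 * π * t) = y at *
  have h2 : y - 1 ≠ 0 := by linarith
  have h3 : y + 1 ≠ 0 := by linarith
  have h4 : y ^ 2 - 1 ≠ 0 := by nlinarith
  have h5 : y ≠ 0 := by linarith
  have h6 : y - y⁻¹ ≠ 0 := by
    intro h
    apply h4
    field_simp at h
    simpa using h
  simp only [Pi.div_apply, exp_y]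
  field_simp
  ring

theorem tendsto_log_tanh :
    Tendsto (fun t => 1 / (2 * π) * log ((exp (2 * π * t) - 1) / (exp (2 * π * t) + 1)))
      atTop (𝓝 0) := by
  have h1 : Tendsto (fun t => exp (2 * π * t)) atTop atTop :=
    tendsto_exp_atTop.comp (tendsto_id.const_mul_atTop (by positivity))
  have h2 : Tendsto (fun t => 1 - 2 / (exp (2 * π * t) + 1)) atTop (𝓝 (1 - 0)) :=
    tendsto_const_nhds.sub ((tendsto_atTop_add_const_right _ _ h1).const_div_atTop 2)
  have h3 := ((continuousAt_log (by norm_num : (1 - 0 : ℝ) ≠ 0)).tendsto.comp h2).const_mul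
    (1 / (2 * π))
  simp only [sub_zero, log_one, mul_zero] at h3
  refine h3.congr fun t => ?_
  have : exp (2 * π * t) + 1 ≠ 0 := by positivity
  simp only [Function.comp]
  congr 2
  field_simp
  ring

theorem one_div_sinh_nonneg {t : ℝ} (ht : 0 < t) : 0 ≤ 1 / sinh (2 * π * t) :=
  one_div_nonneg.2 (sinh_nonneg_iff.2 (by positivity))

theorem integrable_indicator_one_div_sinh {δ : ℝ} (hδ : 0 < δ) :
    Integrable ((Ioi δ).indicator fun u => 1 / sinh (2 * π * u)) :=
  (integrableOn_Ioi_deriv_of_nonneg' (fun _ hx => hasDerivAt_log_tanh (hδ.trans_le hx))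
    (fun _ hx => one_div_sinh_nonneg (hδ.trans hx)) tendsto_log_tanh).integrable_indicator
    measurableSet_Ioi

theorem integrable_truncKernel {δ : ℝ} (hδ : 0 < δ) : Integrable (truncKernel δ) := by
  have h := integrable_indicator_one_div_sinh hδ
  exact (h.add h.comp_neg).congr (.of_forall fun t => (truncKernel_eq hδ t).symm)

theorem integral_truncKernel {δ : ℝ} (hδ : 0 < δ) :
    ∫ t, truncKernel δ t =
      1 / π * log ((exp (2 * π * δ) + 1) / (exp (2 * π * δ) - 1)) := by
  have h := integrable_indicator_one_div_sinh hδ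
  have h1 := one_lt_exp_two_pi_mul hδ
  simp only [truncKernel_eq hδ]
  rw [integral_add h h.comp_neg, integral_neg_eq_self, integral_indicator measurableSet_Ioi,
    integral_Ioi_of_hasDerivAt_of_nonneg' (fun x hx => hasDerivAt_log_tanh (hδ.trans_le hx))
      (fun x hx => one_div_sinh_nonneg (hδ.trans hx)) tendsto_log_tanh,
    ← inv_div (exp (2 * π * δ) - 1), log_inv]
  field_simp
  ring

/-- For this cutoff the truncated kernel has exactly the `L¹`-norm that the normalization of the
block-encoding asks for. -/
theorem integral_truncKernel_cutoff {h ε : ℝ} (hh : 0 < h) (hε : 0 < ε) :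
    ∫ t, truncKernel (1 / (2 * π) * log (1 + π * ε / h)) t =
      1 / π * log (1 + 2 * h / (π * ε)) := by
  have hx : 0 < π * ε / h := by positivity
  have hlog : 0 < log (1 + π * ε / h) := log_pos (by linarith)
  rw [integral_truncKernel (by positivity)]
  have : 2 * π * (1 / (2 * π) * log (1 + π * ε / h)) = log (1 + π * ε / h) := by field_simp
  rw [this, exp_log (by linarith)]
  congr 2
  field_simp
  ring

/-- The kernel decays like `e^{-2πt}`, and `e^{-2π ln (1/ε)}` is at most `ε³`. -/
theorem integral_truncKernel_tail {ε : ℝ} (hε : 0 < ε) (hε' : ε ≤ 1 / 3) :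
    ∫ t, truncKernel (log (1 / ε)) t ≤ ε / 12 := by
  have h3 : 3 ≤ 1 / ε := by rw [le_div_iff₀ hε]; linarith
  have hT : 0 < log (1 / ε) := log_pos (by linarith)
  rw [integral_truncKernel hT]
  have hy : 9 * (1 / ε) ≤ exp (2 * π * log (1 / ε)) := by
    have h : exp (3 * log (1 / ε)) = (1 / ε) ^ 3 := by
      rw [mul_comm, exp_mul, exp_log (by positivity)]
      norm_cast
    calc 9 * (1 / ε) ≤ (1 / ε) ^ 3 := by nlinarith [mul_nonneg (sub_nonneg.2 h3) (sub_nonneg.2 h3)]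
      _ = exp (3 * log (1 / ε)) := h.symm
      _ ≤ _ := exp_le_exp.2 (by nlinarith [pi_gt_three])
  set y := exp (2 * π * log (1 / ε)) with hydef
  have hy1 : 8 * (1 / ε) ≤ y - 1 := by linarith
  have hy2 : 0 < y - 1 := by linarith
  have hl : log ((y + 1) / (y - 1)) ≤ ε / 4 := by
    refine (log_le_sub_one_of_pos (div_pos (by linarith) hy2)).trans ?_
    rw [div_sub_one hy2.ne', div_le_iff₀ hy2]
    have : ε * (1 / ε) = 1 := by field_simp
    nlinarith
  have hπ : 1 / π ≤ 1 / 3 := one_div_le_one_div_of_le (by norm_num) pi_gt_three.le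
  have hl0 : 0 ≤ log ((y + 1) / (y - 1)) := log_nonneg (by rw [le_div_iff₀ hy2]; linarith)
  nlinarith

theorem abs_one_div_sinh (t : ℝ) : |1 / sinh (2 * π * t)| = 1 / sinh (2 * π * |t|) := by
  have : 2 * π * |t| = |2 * π * t| := by rw [abs_mul, abs_of_pos two_pi_pos]
  rw [abs_div, abs_one, abs_sinh, this]

/-- The singularity of the kernel at `0` is of first order, with the constant `1 / (2π)`. -/
theorem one_div_sinh_mul_abs_le (t : ℝ) : 1 / sinh (2 * π * |t|) * |t| ≤ 1 / (2 * π) := by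
  rcases eq_or_ne t 0 with rfl | ht
  · simp
    positivity
  · have h0 : 0 < |t| := abs_pos.2 ht
    have h : 2 * π * |t| ≤ sinh (2 * π * |t|) := self_le_sinh_iff.2 (by positivity)
    have hs : 0 < sinh (2 * π * |t|) := lt_of_lt_of_le (by positivity) h
    rw [one_div_mul_eq_div, div_le_div_iff₀ hs (by positivity)]
    linarith

theorem truncKernel_mul_sign (δ t : ℝ) :
    truncKernel δ t * (if 0 ≤ t then 1 else -1) =
      if δ < |t| then 1 / sinh (2 * π * t) else 0 := by
  unfold truncKernel
  split_ifs with h h'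
  · simp [abs_of_nonneg h']
  · rw [abs_of_neg (not_le.1 h')]
    simp [div_neg]
  all_goals simp

theorem integral_odd_truncKernel (δ : ℝ) :
    ∫ t, (if δ < |t| then 1 / sinh (2 * π * t) else 0) = 0 := by
  have h := integral_neg_eq_self (fun t => if δ < |t| then 1 / sinh (2 * π * t) else 0) volume
  have h' : (fun t => if δ < |(-t)| then 1 / sinh (2 * π * (-t)) else 0) =
      fun t => -(if δ < |t| then 1 / sinh (2 * π * t) else 0) := by
    ext t
    simp only [abs_neg]
    split_ifs <;> simp [div_neg]
  rw [h', integral_neg] at h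
  linarith

end Kernel

/-! ### Discretization of time -/

section Thermometer

open Real

/-- The thermometer code of the time `t ∈ [-T, T]` on the grid of mesh `T / M`: as many of the first
qubits are set to `1` as there are complete mesh intervals between `-T` and `t`. Times outside of
`[-T, T]` have the code of the nearer endpoint. -/
noncomputable def thermometer (T : ℝ) (M : ℕ) (t : ℝ) : Qubits (2 * M) :=
  fun k => if -T + ((k : ℕ) + 1) * (T / M) ≤ t then 1 else 0

theorem measurable_thermometer (T : ℝ) (M : ℕ) : Measurable (thermometer T M) :=
  measurable_pi_lambda _ fun _ => Measurable.ite measurableSet_Ici measurable_const measurable_const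

/-- Since `0` is a grid point, one of the qubits of the thermometer code holds the sign of `t`. -/
theorem thermometer_middle {T : ℝ} {M : ℕ} (hM : 0 < M) (t : ℝ) :
    thermometer T M t ⟨M - 1, by omega⟩ = 1 ↔ 0 ≤ t := by
  have hM' : (M : ℝ) ≠ 0 := by positivity
  have : -T + (((M - 1 : ℕ) : ℝ) + 1) * (T / M) = 0 := by
    rw [Nat.cast_pred hM]
    field_simp
    ring
  simp [thermometer, this]

theorem abs_thermometerTime_sub_le {T : ℝ} (hT : 0 < T) {M : ℕ} (hM : 0 < M) {t : ℝ}
    (ht : |t| ≤ T) :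
    |t - thermometerTime (-T) (T / M) (thermometer T M t)| ≤ T / M := by
  have hM' : (0 : ℝ) < M := by positivity
  have hΔ : 0 < T / M := by positivity
  obtain ⟨h1, h2⟩ := abs_le.1 ht
  have hx : 0 ≤ (t + T) / (T / M) := div_nonneg (by linarith) hΔ.le
  -- The qubits that are set are exactly the first `⌊(t + T) / (T / M)⌋` ones.
  set n := ⌊(t + T) / (T / M)⌋₊ with hn
  have hn2 : n ≤ 2 * M := by
    refine Nat.floor_le_of_le ?_
    rw [div_le_iff₀ hΔ]
    push_cast
    have : 2 * (M : ℝ) * (T / M) = 2 * T := by field_simp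
    linarith
  have hk : ∀ k : Fin (2 * M), thermometer T M t k = 1 ↔ (k : ℕ) < n := by
    intro k
    rw [hn, ← Nat.succ_le_iff, Nat.le_floor_iff hx, le_div_iff₀ hΔ]
    simp only [thermometer, Nat.succ_eq_add_one, Nat.cast_add, Nat.cast_one]
    split_ifs with h
    · simp only [true_iff]
      linarith
    · simp only [zero_ne_one, false_iff]
      intro h'
      exact h (by linarith)
  have hsum : thermometerTime (-T) (T / M) (thermometer T M t) = -T + n * (T / M) := by
    simp only [thermometerTime, hk]
    rw [Fin.sum_univ_eq_sum_range (fun k => if k < n then T / (M : ℝ) else 0),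
      ← Finset.sum_filter, Finset.sum_const, nsmul_eq_mul]
    congr 3
    rw [show (Finset.range (2 * M)).filter (· < n) = Finset.range n by ext; simp; omega,
      Finset.card_range]
  have hl := Nat.floor_le hx
  have hu := Nat.lt_floor_add_one ((t + T) / (T / M))
  rw [← hn, le_div_iff₀ hΔ] at hl
  rw [← hn, div_lt_iff₀ hΔ] at hu
  rw [hsum, abs_le]
  constructor <;> linarith

open MeasureTheory in
/-- Integrating a function of a finite-valued map `σ` against the density `k` is a finite sum. -/
theorem integral_smul_comp_eq_sum {α S E : Type*} [MeasurableSpace α] {μ : Measure α}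
    [Fintype S] [MeasurableSpace S] [MeasurableSingletonClass S]
    [NormedAddCommGroup E] [NormedSpace ℝ E] [CompleteSpace E] {k : α → ℝ} (hk : Integrable k μ)
    {σ : α → S} (hσ : Measurable σ) (F : S → E) :
    Integrable (fun t => k t • F (σ t)) μ ∧
      ∫ t, k t • F (σ t) ∂μ = ∑ s, (∫ t in σ ⁻¹' {s}, k t ∂μ) • F s := by
  classical
  have hms : ∀ s, MeasurableSet (σ ⁻¹' {s}) := fun s => hσ (measurableSet_singleton s)
  have hint : ∀ s, Integrable (fun t => (σ ⁻¹' {s}).indicator k t • F s) μ := fun s =>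
    (hk.indicator (hms s)).smul_const _
  have heq : (fun t => k t • F (σ t)) = fun t => ∑ s, (σ ⁻¹' {s}).indicator k t • F s := by
    ext t
    rw [Finset.sum_eq_single (σ t)]
    · simp
    · intro s _ hs
      simp [Set.indicator, hs.symm]
    · simp
  rw [heq]
  refine ⟨integrable_finsetSum _ fun s _ => hint s, ?_⟩
  rw [integral_finsetSum _ fun s _ => hint s]
  refine Finset.sum_congr rfl fun s _ => ?_
  rw [integral_smul_const, integral_indicator (hms s)]

end Thermometer

/-! ### The discretized superoperator -/

section Discretization

open MeasureTheory Real

variable {d : ℕ} {H : Matrix (Fin d) (Fin d) ℂ}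

/-- The phase of the kernel `i / sinh (2πt)`, read off from the thermometer code of `t`. -/
noncomputable def kernelPhase {M : ℕ} (s : Qubits (2 * M)) : ℂ :=
  if ∃ k : Fin (2 * M), (k : ℕ) + 1 = M ∧ s k = 1 then Complex.I else -Complex.I

theorem norm_kernelPhase {M : ℕ} (s : Qubits (2 * M)) : ‖kernelPhase s‖ = 1 := by
  unfold kernelPhase
  split_ifs <;> simp

theorem kernelPhase_thermometer (T : ℝ) {M : ℕ} (hM : 0 < M) (t : ℝ) :
    kernelPhase (thermometer T M t) = ((if 0 ≤ t then 1 else -1 : ℝ) : ℂ) * Complex.I := by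
  have h : (∃ k : Fin (2 * M), (k : ℕ) + 1 = M ∧ thermometer T M t k = 1) ↔ 0 ≤ t := by
    rw [← thermometer_middle hM (T := T)]
    refine ⟨?_, fun h => ⟨_, by simp; omega, h⟩⟩
    rintro ⟨k, hk, h⟩
    rwa [show (⟨M - 1, by omega⟩ : Fin (2 * M)) = k from Fin.ext (by simp; omega)]
  simp only [kernelPhase, h]
  split_ifs <;> simp

/-- The mass which the truncated kernel gives to the times with thermometer code `s`. -/
noncomputable def kernelMass (δ T : ℝ) {M : ℕ} (s : Qubits (2 * M)) : ℝ :=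
  ∫ t in thermometer T M ⁻¹' {s}, truncKernel δ t

theorem kernelMass_nonneg (δ T : ℝ) {M : ℕ} (s : Qubits (2 * M)) : 0 ≤ kernelMass δ T s :=
  integral_nonneg fun t => truncKernel_nonneg δ t

theorem sum_kernelMass {δ : ℝ} (hδ : 0 < δ) (T : ℝ) (M : ℕ) :
    ∑ s : Qubits (2 * M), kernelMass δ T s = ∫ t, truncKernel δ t := by
  have h := (integral_smul_comp_eq_sum (integrable_truncKernel hδ) (measurable_thermometer T M)
    (fun _ => (1 : ℝ))).2
  simpa [kernelMass] using h.symm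

/-- The discretization of `superS`: the kernel is cut off near `0`, and the time is rounded to the
grid. The subtracted term `A` is absent, since the truncated kernel is odd. -/
noncomputable def discreteS (H : Matrix (Fin d) (Fin d) ℂ) (δ T : ℝ) (M : ℕ) :
    Matrix (Fin d) (Fin d) ℂ →ₗ[ℂ] Matrix (Fin d) (Fin d) ℂ where
  toFun A := ∑ s : Qubits (2 * M), ((kernelMass δ T s : ℂ) * kernelPhase s) •
    heisenberg H A (thermometerTime (-T) (T / M) s)
  map_add' A B := by
    simp only [heisenberg, mul_add, add_mul, smul_add, Finset.sum_add_distrib]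
  map_smul' c A := by
    simp only [heisenberg, mul_smul_comm, smul_mul_assoc, Finset.smul_sum, RingHom.id_apply]
    exact Finset.sum_congr rfl fun s _ => smul_comm _ _ _

theorem discreteS_apply (δ T : ℝ) (M : ℕ) (A : Matrix (Fin d) (Fin d) ℂ) :
    discreteS H δ T M A = ∑ s : Qubits (2 * M), ((kernelMass δ T s : ℂ) * kernelPhase s) •
      heisenberg H A (thermometerTime (-T) (T / M) s) := rfl

theorem smul_kernelPhase (δ T : ℝ) {M : ℕ} (hM : 0 < M) (t : ℝ)
    (X : Matrix (Fin d) (Fin d) ℂ) :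
    truncKernel δ t • (kernelPhase (thermometer T M t) • X) =
      ((if δ < |t| then 1 / sinh (2 * π * t) else 0 : ℝ) : ℂ) • (Complex.I • X) := by
  rw [kernelPhase_thermometer T hM, mul_smul, ← Complex.coe_smul, smul_smul, ← Complex.ofReal_mul,
    truncKernel_mul_sign]

/-- Since the truncated kernel is odd, `A` may be subtracted again in the integral representation
of the discretized superoperator. -/
theorem discreteS_eq_integral {δ : ℝ} (hδ : 0 < δ) (T : ℝ) {M : ℕ} (hM : 0 < M)
    (A : Matrix (Fin d) (Fin d) ℂ) :
    Integrable (fun t => truncKernel δ t • (kernelPhase (thermometer T M t) •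
      (heisenberg H A (thermometerTime (-T) (T / M) (thermometer T M t)) - A))) ∧
    discreteS H δ T M A = ∫ t, truncKernel δ t • (kernelPhase (thermometer T M t) •
      (heisenberg H A (thermometerTime (-T) (T / M) (thermometer T M t)) - A)) := by
  have hk := integrable_truncKernel hδ
  have hσ := measurable_thermometer T M
  have h₁ := integral_smul_comp_eq_sum hk hσ
    (fun s => kernelPhase s • heisenberg H A (thermometerTime (-T) (T / M) s))
  have h₂ := integral_smul_comp_eq_sum hk hσ (fun s => kernelPhase s • A)
  have h₀ : ∫ t, truncKernel δ t • (kernelPhase (thermometer T M t) • A) = 0 := by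
    simp only [smul_kernelPhase δ T hM]
    rw [integral_smul_const, integral_complex_ofReal, integral_odd_truncKernel,
      Complex.ofReal_zero, zero_smul]
  simp only [smul_sub]
  refine ⟨h₁.1.sub h₂.1, ?_⟩
  rw [integral_sub h₁.1 h₂.1, h₀, sub_zero, h₁.2]
  refine Finset.sum_congr rfl fun s _ => ?_
  rw [mul_smul, Complex.coe_smul]
  rfl

/-- The integrand of `superS` is bounded near `t = 0` because `‖e^{iHt} A e^{-iHt} - A‖` is at most
linear in `t`, and it is bounded by the kernel elsewhere. -/
theorem norm_superS_integrand_le (hH : H.IsHermitian) {A : Matrix (Fin d) (Fin d) ℂ}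
    (hA : ‖A‖ ≤ 1) (t : ℝ) :
    ‖(Complex.I / ((sinh (2 * π * t) : ℝ) : ℂ)) • (heisenberg H A t - A)‖ ≤ ‖H‖ / π := by
  have hn : ‖Complex.I / ((sinh (2 * π * t) : ℝ) : ℂ)‖ = 1 / sinh (2 * π * |t|) := by
    rw [← abs_one_div_sinh, norm_div, Complex.norm_I, Complex.norm_real, norm_eq_abs, abs_div,
      abs_one]
  have hs : 0 ≤ 1 / sinh (2 * π * |t|) := by
    rw [← abs_one_div_sinh]
    exact abs_nonneg _
  have hd : ‖heisenberg H A t - A‖ ≤ 2 * ‖H‖ * |t| := by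
    have h := norm_heisenberg_sub_le hH A 0 t
    rw [heisenberg_zero, sub_zero] at h
    refine h.trans (mul_le_mul_of_nonneg_right ?_ (abs_nonneg t))
    exact mul_le_of_le_one_right (by positivity) hA
  rw [norm_smul, hn]
  calc _ ≤ 1 / sinh (2 * π * |t|) * (2 * ‖H‖ * |t|) := mul_le_mul_of_nonneg_left hd hs
    _ = 2 * ‖H‖ * (1 / sinh (2 * π * |t|) * |t|) := by ring
    _ ≤ 2 * ‖H‖ * (1 / (2 * π)) :=
      mul_le_mul_of_nonneg_left (one_div_sinh_mul_abs_le t) (by positivity)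
    _ = ‖H‖ / π := by field_simp

theorem norm_heisenberg_sub_heisenberg_le_two (hH : H.IsHermitian)
    {A : Matrix (Fin d) (Fin d) ℂ} (hA : ‖A‖ ≤ 1) (s t : ℝ) :
    ‖heisenberg H A t - heisenberg H A s‖ ≤ 2 := by
  refine (norm_sub_le _ _).trans ?_
  rw [norm_heisenberg hH, norm_heisenberg hH]
  linarith

/-- The pointwise error of the discretization: the cutoff is responsible for the first term, the
rounding of the time for the second and the range of the grid for the third. -/
theorem norm_integrand_sub_le (hH : H.IsHermitian) {A : Matrix (Fin d) (Fin d) ℂ}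
    (hA : ‖A‖ ≤ 1) {δ T : ℝ} (hT : 0 < T) {M : ℕ} (hM : 0 < M) (t : ℝ) :
    ‖(Complex.I / ((sinh (2 * π * t) : ℝ) : ℂ)) • (heisenberg H A t - A) -
      truncKernel δ t • (kernelPhase (thermometer T M t) •
        (heisenberg H A (thermometerTime (-T) (T / M) (thermometer T M t)) - A))‖ ≤
    (Set.Icc (-δ) δ).indicator (fun _ => ‖H‖ / π) t + 2 * ‖H‖ * (T / M) * truncKernel δ t +
      2 * truncKernel T t := by
  rw [smul_kernelPhase δ T hM]
  have hΔ : 0 ≤ 2 * ‖H‖ * (T / M) := by positivity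
  have hk1 := mul_nonneg hΔ (truncKernel_nonneg δ t)
  have hk2 := truncKernel_nonneg T t
  by_cases h : δ < |t|
  · have hi : 0 ≤ (Set.Icc (-δ) δ).indicator (fun _ => ‖H‖ / π) t :=
      Set.indicator_nonneg (fun _ _ => by positivity) t
    set τ := thermometerTime (-T) (T / M) (thermometer T M t) with hτ
    have hterm : (Complex.I / ((sinh (2 * π * t) : ℝ) : ℂ)) • (heisenberg H A t - A) -
        ((if δ < |t| then 1 / sinh (2 * π * t) else 0 : ℝ) : ℂ) •
          (Complex.I • (heisenberg H A τ - A)) =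
        (((1 / sinh (2 * π * t) : ℝ) : ℂ) * Complex.I) •
          (heisenberg H A t - heisenberg H A τ) := by
      rw [if_pos h, smul_smul]
      push_cast
      rw [one_div_mul_eq_div, ← smul_sub, sub_sub_sub_cancel_right]
    have hδk : truncKernel δ t = 1 / sinh (2 * π * |t|) := if_pos h
    rw [hterm, norm_smul, norm_mul, Complex.norm_I, mul_one, Complex.norm_real, norm_eq_abs,
      abs_one_div_sinh, ← hδk]
    rcases le_or_gt |t| T with h' | h'
    · have hd : ‖heisenberg H A t - heisenberg H A τ‖ ≤ 2 * ‖H‖ * (T / M) := by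
        refine (norm_heisenberg_sub_le hH A τ t).trans ?_
        refine mul_le_mul ?_ (abs_thermometerTime_sub_le hT hM h') (abs_nonneg _) (by positivity)
        exact mul_le_of_le_one_right (by positivity) hA
      have := mul_le_mul_of_nonneg_left hd (truncKernel_nonneg δ t)
      linarith
    · have hTk : truncKernel T t = truncKernel δ t := by rw [hδk, truncKernel, if_pos h']
      have := mul_le_mul_of_nonneg_left
        (norm_heisenberg_sub_heisenberg_le_two hH hA τ t) (truncKernel_nonneg δ t)
      linarith
  · have hm : t ∈ Set.Icc (-δ) δ := abs_le.1 (not_lt.1 h)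
    rw [if_neg h, Set.indicator_of_mem hm]
    have := norm_superS_integrand_le hH hA t
    simp only [Complex.ofReal_zero, zero_smul, sub_zero]
    linarith

theorem integrable_superS_integrand (hH : H.IsHermitian) {A : Matrix (Fin d) (Fin d) ℂ}
    (hA : ‖A‖ ≤ 1) :
    Integrable fun t : ℝ =>
      (Complex.I / ((sinh (2 * π * t) : ℝ) : ℂ)) • (heisenberg H A t - A) := by
  -- Any cutoff serves for the dominating function; it is placed at `|t| = 1`.
  have hb : Integrable fun t : ℝ =>
      (Set.Icc (-1) 1).indicator (fun _ => ‖H‖ / π) t + 2 * truncKernel 1 t :=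
    (integrableOn_const (by simp)).integrable_indicator measurableSet_Icc |>.add
      ((integrable_truncKernel one_pos).const_mul 2)
  refine hb.mono' ?_ (.of_forall fun t => ?_)
  · have hm : Measurable fun t : ℝ => Complex.I / ((sinh (2 * π * t) : ℝ) : ℂ) := by fun_prop
    exact hm.aestronglyMeasurable.smul
      ((continuous_heisenberg H A).sub continuous_const).aestronglyMeasurable
  · have hk := truncKernel_nonneg 1 t
    by_cases h : 1 < |t|
    · have hd := norm_heisenberg_sub_heisenberg_le_two hH hA 0 t
      rw [heisenberg_zero] at hd
      have hk' : truncKernel 1 t = 1 / sinh (2 * π * |t|) := if_pos h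
      have hn : ‖Complex.I / ((sinh (2 * π * t) : ℝ) : ℂ)‖ = truncKernel 1 t := by
        rw [hk', ← abs_one_div_sinh, norm_div, Complex.norm_I, Complex.norm_real, norm_eq_abs,
          abs_div, abs_one]
      have hi : 0 ≤ (Set.Icc (-1) 1).indicator (fun _ => ‖H‖ / π) t :=
        Set.indicator_nonneg (fun _ _ => by positivity) t
      rw [norm_smul, hn]
      have := mul_le_mul_of_nonneg_left hd hk
      linarith
    · have hm : t ∈ Set.Icc (-1) 1 := abs_le.1 (not_lt.1 h)
      rw [Set.indicator_of_mem hm]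
      linarith [norm_superS_integrand_le hH hA t]

theorem norm_superS_sub_discreteS_le (hH : H.IsHermitian) {A : Matrix (Fin d) (Fin d) ℂ}
    (hA : ‖A‖ ≤ 1) {δ T : ℝ} (hδ : 0 < δ) (hT : 0 < T) {M : ℕ} (hM : 0 < M) :
    ‖superS H A - discreteS H δ T M A‖ ≤
      2 * δ * (‖H‖ / π) + 2 * ‖H‖ * (T / M) * (∫ t, truncKernel δ t) +
        2 * ∫ t, truncKernel T t := by
  obtain ⟨hint, heq⟩ := discreteS_eq_integral (H := H) hδ T hM A
  have h₁ : Integrable ((Set.Icc (-δ) δ).indicator (fun _ : ℝ => ‖H‖ / π)) :=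
    (integrableOn_const (by simp)).integrable_indicator measurableSet_Icc
  have h₂ := (integrable_truncKernel hδ).const_mul (2 * ‖H‖ * (T / M))
  have h₃ := (integrable_truncKernel hT).const_mul 2
  have hS : superS H A = ∫ t : ℝ,
      (Complex.I / ((sinh (2 * π * t) : ℝ) : ℂ)) • (heisenberg H A t - A) := rfl
  rw [hS, heq, ← integral_sub (integrable_superS_integrand hH hA) hint]
  refine (norm_integral_le_of_norm_le ((h₁.add h₂).add h₃)
    (.of_forall fun t => norm_integrand_sub_le hH hA hT hM t)).trans_eq ?_
  rw [integral_add' (h₁.add h₂) h₃, integral_add' h₁ h₂, integral_const_mul, integral_const_mul,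
    integral_indicator measurableSet_Icc, setIntegral_const, smul_eq_mul, volume_real_Icc_of_le
    (by linarith)]
  ring

/-- Unitaries of the work register whose first row and column have the normalized coefficients of
the discretized superoperator as their products: each amplitude is the square root of the mass,
and the row carries the phase. -/
theorem exists_unitary_kernelMass {δ : ℝ} (hδ : 0 < δ) (T : ℝ) (M : ℕ)
    (hpos : 0 < ∫ t, truncKernel δ t) :
    ∃ P Q : Matrix.unitaryGroup (Qubits (2 * M)) ℂ, ∀ s,
      (Q : Matrix (Qubits (2 * M)) (Qubits (2 * M)) ℂ) 0 s *
        (P : Matrix (Qubits (2 * M)) (Qubits (2 * M)) ℂ) s 0 =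
      ((∫ t, truncKernel δ t : ℝ) : ℂ)⁻¹ * ((kernelMass δ T s : ℂ) * kernelPhase s) := by
  set N := ∫ t, truncKernel δ t with hN
  have hw : ∀ s : Qubits (2 * M), 0 ≤ kernelMass δ T s / N := fun s =>
    div_nonneg (kernelMass_nonneg δ T s) hpos.le
  have hsum : ∑ s : Qubits (2 * M), kernelMass δ T s / N = 1 := by
    rw [← Finset.sum_div, sum_kernelMass hδ, ← hN, div_self hpos.ne']
  obtain ⟨P, hP⟩ := exists_unitary_col (0 : Qubits (2 * M))
    (fun s => ((√(kernelMass δ T s / N) : ℝ) : ℂ))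
    (by simpa only [Complex.norm_real, norm_eq_abs, sq_abs, sq_sqrt (hw _)] using hsum)
  obtain ⟨Q, hQ⟩ := exists_unitary_row (0 : Qubits (2 * M))
    (fun s => kernelPhase s * ((√(kernelMass δ T s / N) : ℝ) : ℂ))
    (by simpa only [norm_mul, norm_kernelPhase, one_mul, Complex.norm_real, norm_eq_abs, sq_abs,
      sq_sqrt (hw _)] using hsum)
  refine ⟨P, Q, fun s => ?_⟩
  rw [hP, hQ, mul_assoc, ← Complex.ofReal_mul, mul_self_sqrt (hw s), Complex.ofReal_div]
  ring

end Discretization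

end QGibbs

theorem mainTheorem11 :
    ∃ C : ℝ, 0 < C ∧
      ∀ h ε : ℝ, 0 < h → 0 < ε → ε ≤ 1 / 3 →
        ∃ (m : ℕ) (c : QGibbs.Algorithm m),
          QGibbs.Algorithm.queries c = 1 ∧
          QGibbs.Algorithm.simTime c ≤ C * Real.log (1 / ε) ∧
          ∀ (d : ℕ) (H : Matrix (Fin d) (Fin d) ℂ), H.IsHermitian → ‖H‖ = h →
            ∃ S' : Matrix (Fin d) (Fin d) ℂ →ₗ[ℂ] Matrix (Fin d) (Fin d) ℂ,
              ∀ A : Matrix (Fin d) (Fin d) ℂ, ‖A‖ ≤ 1 →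
                ‖QGibbs.superS H A - S' A‖ ≤ ε ∧
                ∀ (a : ℕ)
                  (U : Matrix (QGibbs.Qubits a × Fin d) (QGibbs.Qubits a × Fin d) ℂ),
                  QGibbs.IsBlockEncoding U A →
                    QGibbs.IsBlockEncoding (QGibbs.Algorithm.eval H U c)
                      (((Real.pi / Real.log (1 + 2 * ‖H‖ / (Real.pi * ε)) : ℝ) : ℂ) • S' A) := by
  refine ⟨6, by norm_num, fun h ε hh hε hε' => ?_⟩
  have hπ := Real.pi_gt_three
  have h3 : 3 ≤ 1 / ε := by rw [le_div_iff₀ hε]; linarith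
  have hT : 0 < Real.log (1 / ε) := Real.log_pos (by linarith)
  have hx : 0 < Real.pi * ε / h := by positivity
  have hlog : 0 < Real.log (1 + Real.pi * ε / h) := Real.log_pos (by linarith)
  have hx' : 0 < 2 * h / (Real.pi * ε) := by positivity
  have hlog' : 0 < Real.log (1 + 2 * h / (Real.pi * ε)) := Real.log_pos (by linarith)
  have hN := QGibbs.integral_truncKernel_cutoff hh hε
  have htail := QGibbs.integral_truncKernel_tail hε hε'
  set T := Real.log (1 / ε)
  obtain ⟨δ, hδ_def⟩ : ∃ δ, δ = 1 / (2 * Real.pi) * Real.log (1 + Real.pi * ε / h) := ⟨_, rfl⟩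
  have hδ : 0 < δ := by rw [hδ_def]; positivity
  rw [← hδ_def] at hN
  have hNpos : 0 < ∫ t, QGibbs.truncKernel δ t := by rw [hN]; positivity
  -- The cutoff costs at most `ε / π`.
  have hδ_le : 2 * δ * (h / Real.pi) ≤ ε / 3 := by
    have hl : Real.log (1 + Real.pi * ε / h) ≤ Real.pi * ε / h := by
      have := Real.log_le_sub_one_of_pos (show 0 < 1 + Real.pi * ε / h by linarith)
      linarith
    calc 2 * δ * (h / Real.pi)
        = h / Real.pi ^ 2 * Real.log (1 + Real.pi * ε / h) := by rw [hδ_def]; field_simp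
      _ ≤ h / Real.pi ^ 2 * (Real.pi * ε / h) := mul_le_mul_of_nonneg_left hl (by positivity)
      _ = ε / Real.pi := by field_simp
      _ ≤ ε / 3 := div_le_div_of_nonneg_left hε.le (by norm_num) hπ.le
  set N := ∫ t, QGibbs.truncKernel δ t
  -- The mesh of the grid is free, since only the total simulation time is bounded.
  obtain ⟨M, hM⟩ := exists_nat_gt (4 * h * T * N / ε)
  have hMpos' : (0 : ℝ) < M := lt_of_le_of_lt (by positivity) hM
  have hMpos : 0 < M := by exact_mod_cast hMpos'
  have hmesh : 2 * h * (T / M) * N ≤ ε / 2 := by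
    rw [div_lt_iff₀ hε] at hM
    rw [show 2 * h * (T / M) * N = 2 * h * T * N / M by ring, div_le_iff₀ hMpos']
    linarith
  obtain ⟨P, Q, hPQ⟩ := QGibbs.exists_unitary_kernelMass hδ T M hNpos
  refine ⟨2 * M, QGibbs.lcuAlgorithm P Q (-T) (T / M), QGibbs.queries_lcuAlgorithm _ _ _ _, ?_,
    fun d H hH hHh => ⟨QGibbs.discreteS H δ T M, fun A hA => ⟨?_, fun a U hU => ?_⟩⟩⟩
  · rw [QGibbs.simTime_lcuAlgorithm, abs_neg, abs_of_pos hT, abs_of_pos (div_pos hT hMpos')]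
    push_cast
    have : 2 * (M : ℝ) * (T / M) = 2 * T := by field_simp
    linarith
  · have := QGibbs.norm_superS_sub_discreteS_le hH hA hδ hT hMpos
    rw [hHh] at this
    linarith
  · convert QGibbs.isBlockEncoding_lcuAlgorithm hH hU P Q (-T) (T / M) using 1
    have hc : ((Real.pi / Real.log (1 + 2 * ‖H‖ / (Real.pi * ε)) : ℝ) : ℂ) = (N : ℂ)⁻¹ := by
      rw [hHh, hN, ← Complex.ofReal_inv, one_div_mul_eq_div, inv_div]
    simp only [hPQ]
    rw [hc, QGibbs.discreteS_apply, Finset.smul_sum]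
    exact Finset.sum_congr rfl fun s _ => smul_smul _ _ _
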